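/- For $n\ge 0$ let $c_n$ be the number of permutations $\pi=\pi_1\pi_2\cdots\pi_n$ of $\{1,\dots,n\}$ that contain exactly one occurrence of the classical pattern $1\text{-}2\text{-}3$, that is, for which there is exactly one triple of positions $i<j<k$ with $\pi_i<\pi_j<\pi_k$ (so $c_0=c_1=c_2=0$). Let $$C(x)=\frac{1-\sqrt{1-4x}}{2x}=\sum_{n\ge 0}\frac{1}{n+1}\binom{2n}{n}x^n$$ be the generating function of the Catalan numbers. Then, as formal power series, $$\sum_{n\ge 3} c_n x^n \;=\; x^3\,C(x)^6 \;=\; \sum_{n\ge 3}\frac{6}{n+3}\binom{2n-1}{n+2}x^n .$$ In particular, $c_n=\frac{6}{n+3}\binom{2n-1}{n+2}$ for all $n\ge 3$. -/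

import Mathlib

/-- The occurrences of the classical pattern `p` (of length `k`) in the permutation `π` (of
length `n`): an occurrence is an increasing choice `f` of `k` positions such that the entries of
`π` at these positions, read from left to right, are in the same relative order as the entries
of `p`.  No positions are required to be adjacent. -/
def patternOccurrences {k n : ℕ} (p : Equiv.Perm (Fin k)) (π : Equiv.Perm (Fin n)) :
    Finset (Fin k → Fin n) :=
  Finset.univ.filter fun f =>
    (∀ a b : Fin k, a < b → f a < f b) ∧ (∀ a b : Fin k, π (f a) < π (f b) ↔ p a < p b)

/-- The permutations of length `n` with exactly `m` occurrences of the classical pattern `p`. -/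
def permsWithOccurrences {k : ℕ} (p : Equiv.Perm (Fin k)) (m n : ℕ) :
    Finset (Equiv.Perm (Fin n)) :=
  Finset.univ.filter fun π => (patternOccurrences p π).card = m

/-- The classical pattern `1-2-3`: the increasing permutation of length three. -/
def pattern123 : Equiv.Perm (Fin 3) := 1

/-- The number of permutations of length `n` with exactly one occurrence of `1-2-3`. -/
def numOne123 (n : ℕ) : ℕ := (permsWithOccurrences pattern123 1 n).card

/-- The Catalan generating function, the formal power series whose coefficients are the Catalan
numbers, with rational coefficients. -/
noncomputable def catalanGF : PowerSeries ℚ :=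
  PowerSeries.map (Nat.castRingHom ℚ) PowerSeries.catalanSeries

/-!
# Permutations with exactly one occurrence of `1-2-3`

The proof counts by cutting at the middle entry of the unique occurrence (Burstein's argument).
Let `π = σ₁ a σ₂ b σ₃ c σ₄` have `a b c` as its only increasing triple, with `b` in position `p`.
Every entry before `b` other than `a` exceeds `b`, since otherwise it would form a second triple with
`b c`; likewise every entry after `b` other than `c` is below `b`.  So `σ₁ b σ₂ c` uses exactly the
values `≥ b` and `a σ₃ b σ₄` exactly the values `≤ b`.  Both words avoid `1-2-3`, the first does not
end in its minimum, the second does not start with its maximum, and any two such words can be glued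
back together (`glue`, `card_hasMiddle`).

The avoiders are counted by building a permutation one first entry at a time.  Prepending `v` to an
avoider keeps it an avoider iff the entries that are at least `v` are decreasing, so the number of
avoiders whose entries `≥ m` decrease satisfies the recurrence of Catalan's triangle
(`numAvoidingDecreasing_succ`), and the total is a Catalan number (`card_avoids123`).  Prepending the
maximum is always allowed, which leaves `catalan (k + 1) - catalan k` avoiders of length `k + 1` not
starting with their maximum, and by reverse-complement equally many not ending in their minimum.
With `C = catalanGF`, these numbers have generating function `X * C ^ 3`, and the two pieces share
the entry `b`, so the answer is `X * (X * C ^ 3) ^ 2 = X ^ 3 * C ^ 6`.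

For the coefficients, `X * C ^ 2 = C - 1` expresses `X ^ 3 * C ^ 6 = (C - 1) ^ 3` through `C`
alone, which gives `catalan (n + 2) - 4 * catalan (n + 1) + 3 * catalan n`.
-/

open Equiv (Perm)

/-! ### Counting the permutations that avoid `1-2-3` -/

/-- The permutation has no increasing triple, i.e. it avoids the pattern `1-2-3`. -/
def Avoids123 {n : ℕ} (π : Perm (Fin n)) : Prop :=
  ∀ i j k, i < j → j < k → π i < π j → ¬ π j < π k

/-- The entries of `π` that are at least `m` (as natural numbers) form a decreasing word.
Only the lower entry of a would-be ascent has to be compared with `m`. -/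
def DecreasingFrom {n : ℕ} (m : ℕ) (π : Perm (Fin n)) : Prop :=
  ∀ i j, i < j → m ≤ π i → ¬ π i < π j

/-- The word `v` followed by the entries of `σ`, those that are at least `v` being raised by one. -/
noncomputable def consPerm {n : ℕ} (v : Fin (n + 1)) (σ : Perm (Fin n)) : Perm (Fin (n + 1)) :=
  Equiv.ofBijective (Fin.cons v (v.succAbove ∘ σ) : Fin (n + 1) → Fin (n + 1)) <|
    Finite.injective_iff_bijective.1 <| Fin.cons_injective_iff.2
      ⟨by rintro ⟨i, hi⟩; exact Fin.succAbove_ne v _ hi,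
        (Fin.succAbove_right_injective).comp σ.injective⟩

@[simp] theorem consPerm_zero {n : ℕ} (v : Fin (n + 1)) (σ : Perm (Fin n)) :
    consPerm v σ 0 = v := rfl

@[simp] theorem consPerm_succ {n : ℕ} (v : Fin (n + 1)) (σ : Perm (Fin n)) (i : Fin n) :
    consPerm v σ i.succ = v.succAbove (σ i) := rfl

theorem consPerm_bijective (n : ℕ) :
    Function.Bijective fun x : Fin (n + 1) × Perm (Fin n) => consPerm x.1 x.2 := by
  refine (Fintype.bijective_iff_injective_and_card _).2 ⟨?_, ?_⟩
  · rintro ⟨v, σ⟩ ⟨w, τ⟩ h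
    have hv : v = w := by simpa using congrArg (fun π : Perm (Fin (n + 1)) => π 0) h
    subst hv
    refine Prod.ext rfl (Equiv.ext fun i => ?_)
    simpa using congrArg (fun π : Perm (Fin (n + 1)) => π i.succ) h
  · simp [Fintype.card_perm, Nat.factorial_succ]

/-- Permutations of `n + 1` letters are counted according to their first entry. -/
theorem card_perm_succ_subtype {n : ℕ} (P : Perm (Fin (n + 1)) → Prop) :
    Nat.card {π // P π} = ∑ v : Fin (n + 1), Nat.card {σ // P (consPerm v σ)} := by
  rw [← Nat.card_sigma]
  refine (Nat.card_congr ?_).symm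
  refine Equiv.trans ?_ ((Equiv.ofBijective _ (consPerm_bijective n)).subtypeEquiv
    (p := fun x => P (consPerm x.1 x.2)) fun x => Iff.rfl)
  exact
    { toFun := fun x => ⟨(x.1, x.2.1), x.2.2⟩
      invFun := fun x => ⟨x.1.1, x.1.2, x.2⟩
      left_inv := fun _ => rfl
      right_inv := fun _ => rfl }

theorem avoids123_consPerm {n : ℕ} (v : Fin (n + 1)) (σ : Perm (Fin n)) :
    Avoids123 (consPerm v σ) ↔ Avoids123 σ ∧ DecreasingFrom v σ := by
  have hlt (a b : Fin n) : v.succAbove a < v.succAbove b ↔ a < b :=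
    (Fin.strictMono_succAbove v).lt_iff_lt
  have hv (a : Fin n) : v < v.succAbove a ↔ (v : ℕ) ≤ a := by
    rw [Fin.lt_succAbove_iff_le_castSucc, Fin.le_def, Fin.val_castSucc]
  constructor
  · refine fun h => ⟨fun i j k hij hjk h₁ h₂ => ?_, fun i j hij hi hlt' => ?_⟩
    · exact h i.succ j.succ k.succ (Fin.succ_lt_succ_iff.2 hij) (Fin.succ_lt_succ_iff.2 hjk)
        ((hlt _ _).2 h₁) ((hlt _ _).2 h₂)
    · exact h 0 i.succ j.succ i.succ_pos (Fin.succ_lt_succ_iff.2 hij) ((hv _).2 hi)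
        ((hlt _ _).2 hlt')
  · rintro ⟨h₁, h₂⟩ i j k hij hjk hπ hπ'
    obtain ⟨j, rfl⟩ := Fin.exists_succ_eq.2 (Fin.ne_zero_of_lt hij)
    obtain ⟨k, rfl⟩ := Fin.exists_succ_eq.2 (Fin.ne_zero_of_lt hjk)
    have hjk' := Fin.succ_lt_succ_iff.1 hjk
    have hπ₂ := (hlt _ _).1 hπ'
    induction i using Fin.cases with
    | zero => exact h₂ j k hjk' ((hv _).1 hπ) hπ₂
    | succ i => exact h₁ i j k (Fin.succ_lt_succ_iff.1 hij) hjk' ((hlt _ _).1 hπ) hπ₂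

/-- If `m ≤ v`, then the new first entry is itself among the entries `≥ m`, hence has to be the
maximum `n`. -/
theorem decreasingFrom_consPerm {n m : ℕ} {v : Fin (n + 1)} {σ : Perm (Fin n)}
    (h : DecreasingFrom v σ) :
    DecreasingFrom m (consPerm v σ) ↔ ((v : ℕ) < m ∨ (v : ℕ) = n ∧ DecreasingFrom m σ) := by
  simp only [DecreasingFrom, Fin.forall_fin_succ, consPerm_zero, consPerm_succ,
    Fin.succ_lt_succ_iff, (Fin.strictMono_succAbove v).lt_iff_lt, Fin.lt_succAbove_iff_le_castSucc,
    Fin.not_lt_zero, Fin.succ_pos, lt_self_iff_false] at h ⊢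
  simp only [Fin.le_def, Fin.val_castSucc, IsEmpty.forall_iff, implies_true, true_and,
    forall_const, not_false_eq_true, not_le]
  constructor
  · rintro ⟨h₁, h₂⟩
    by_cases hv : (v : ℕ) < m
    · exact Or.inl hv
    · have hn : (v : ℕ) = n := by
        by_contra hne
        -- The maximum of `σ` would be above `v` in the new word.
        have : n - 1 < (v : ℕ) := by
          have := h₁ (σ.symm ⟨n - 1, by omega⟩) (by omega)
          rw [Equiv.apply_symm_apply] at this
          exact this
        omega
      refine Or.inr ⟨hn, fun i j hij hm => h₂ i j hij ?_⟩
      rw [Fin.succAbove_of_castSucc_lt _ _ (by simp only [Fin.lt_def, Fin.val_castSucc]; omega)]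
      simpa using hm
  · rintro (hv | ⟨hv, h'⟩)
    · refine ⟨fun _ hm => by omega, fun i j hij hm => h i j hij ?_⟩
      by_contra hlt
      rw [Fin.succAbove_of_castSucc_lt _ _ (by simp only [Fin.lt_def, Fin.val_castSucc]; omega)]
        at hm
      simp only [Fin.val_castSucc] at hm
      omega
    · refine ⟨fun i _ => by omega, fun i j hij hm => h' i j hij ?_⟩
      rw [Fin.succAbove_of_castSucc_lt _ _ (by simp only [Fin.lt_def, Fin.val_castSucc]; omega)]
        at hm
      simpa using hm

/-- The number of avoiders of `1-2-3` whose entries `≥ m` decrease: the entry of Catalan's triangle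
in row `n` and column `min m n`. -/
noncomputable def numAvoidingDecreasing (n m : ℕ) : ℕ :=
  Nat.card {π : Perm (Fin n) // Avoids123 π ∧ DecreasingFrom m π}

theorem DecreasingFrom.mono {n m m' : ℕ} {σ : Perm (Fin n)} (h : DecreasingFrom m σ)
    (hm : m ≤ m') : DecreasingFrom m' σ :=
  fun i j hij hi => h i j hij (hm.trans hi)

theorem decreasingFrom_of_le {n m : ℕ} (σ : Perm (Fin n)) (hm : n ≤ m) : DecreasingFrom m σ :=
  fun i _ _ hi => by have := (σ i).isLt; omega

theorem numAvoidingDecreasing_succ (n m : ℕ) :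
    numAvoidingDecreasing (n + 1) m =
      ∑ v ∈ Finset.range (min m n + 1), numAvoidingDecreasing n v := by
  have key (v : Fin (n + 1)) :
      Nat.card {σ : Perm (Fin n) // Avoids123 (consPerm v σ) ∧ DecreasingFrom m (consPerm v σ)} =
        if (v : ℕ) < m then numAvoidingDecreasing n v else
          if (v : ℕ) = n then numAvoidingDecreasing n m else 0 := by
    split_ifs with h₁ h₂
    · refine Nat.card_congr (Equiv.subtypeEquivRight fun σ => ?_)
      rw [avoids123_consPerm]
      exact ⟨fun h => h.1, fun h => ⟨h, (decreasingFrom_consPerm h.2).2 (Or.inl h₁)⟩⟩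
    · refine Nat.card_congr (Equiv.subtypeEquivRight fun σ => ?_)
      rw [avoids123_consPerm]
      constructor
      · rintro ⟨h, h'⟩
        exact ⟨h.1, (((decreasingFrom_consPerm h.2).1 h').resolve_left h₁).2⟩
      · rintro ⟨h, h'⟩
        have hv : DecreasingFrom v σ := h'.mono (by omega)
        exact ⟨⟨h, hv⟩, (decreasingFrom_consPerm hv).2 (Or.inr ⟨h₂, h'⟩)⟩
    · have : IsEmpty {σ : Perm (Fin n) //
          Avoids123 (consPerm v σ) ∧ DecreasingFrom m (consPerm v σ)} := by
        refine ⟨fun ⟨σ, h, h'⟩ => ?_⟩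
        rw [avoids123_consPerm] at h
        rcases (decreasingFrom_consPerm h.2).1 h' with h | h
        · exact h₁ h
        · exact h₂ h.1
      exact Nat.card_of_isEmpty
  rw [numAvoidingDecreasing, card_perm_succ_subtype, Finset.sum_congr rfl fun v _ => key v,
    Fin.sum_univ_eq_sum_range (fun v => if v < m then numAvoidingDecreasing n v else
          if v = n then numAvoidingDecreasing n m else 0) (n + 1)]
  rcases lt_or_ge n m with h | h
  · rw [min_eq_right h.le]
    refine Finset.sum_congr rfl fun v hv => if_pos ?_
    have := Finset.mem_range.1 hv
    omega
  · rw [min_eq_left h, Finset.sum_range_succ, Finset.sum_range_succ, if_neg (by omega), if_pos rfl]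
    congr 1
    rw [← Finset.sum_subset (Finset.range_mono h)]
    · exact Finset.sum_congr rfl fun v hv => if_pos (Finset.mem_range.1 hv)
    · intro v hv hv'
      simp only [Finset.mem_range] at hv hv'
      rw [if_neg hv', if_neg (by omega)]

/-- The closed form of Catalan's triangle, with the denominator `n + 1` cleared. -/
theorem succ_mul_numAvoidingDecreasing (n m : ℕ) (h : m ≤ n) :
    ((n : ℚ) + 1) * numAvoidingDecreasing n m = (n + 1 - m) * (n + m).choose m := by
  induction n generalizing m with
  | zero =>
    obtain rfl : m = 0 := by omega
    have : Unique {π : Perm (Fin 0) // Avoids123 π ∧ DecreasingFrom 0 π} :=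
      { default := ⟨1, fun i => i.elim0, fun i => i.elim0⟩
        uniq := fun _ => Subsingleton.elim _ _ }
    simp [numAvoidingDecreasing]
  | succ n ih =>
    induction m with
    | zero =>
      have := ih 0 (by omega)
      have hn : (n : ℚ) + 1 ≠ 0 := by positivity
      have h1 : (numAvoidingDecreasing n 0 : ℚ) = 1 := by
        apply mul_left_cancel₀ hn
        simpa using this
      rw [numAvoidingDecreasing_succ]
      simp [h1]
    | succ m ihm =>
      have ihm := ihm (by omega)
      rcases Nat.lt_or_ge m n with hmn | hmn
      · -- Subtracting neighbouring partial sums gives the triangle recurrence.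
        have hrec : numAvoidingDecreasing (n + 1) (m + 1) =
            numAvoidingDecreasing (n + 1) m + numAvoidingDecreasing n (m + 1) := by
          rw [numAvoidingDecreasing_succ, numAvoidingDecreasing_succ, min_eq_left (by omega),
            min_eq_left (by omega), Finset.sum_range_succ]
        have ih' := ih (m + 1) (by omega)
        have e1 := Nat.add_one_mul_choose_eq (n + m + 1) m
        have e2 := Nat.choose_succ_right_eq (n + m + 1) m
        rw [show n + m + 1 - m = n + 1 by omega] at e2
        rw [show n + 1 + (m + 1) = n + m + 1 + 1 by ring, hrec]
        rw [show n + 1 + m = n + m + 1 by ring] at ihm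
        rw [show n + (m + 1) = n + m + 1 by ring] at ih'
        qify at e1 e2
        push_cast at *
        generalize ((n + m + 1).choose m : ℚ) = c at *
        generalize ((n + m + 1).choose (m + 1) : ℚ) = d at *
        generalize ((n + m + 1 + 1).choose (m + 1) : ℚ) = e at *
        have hn : (n : ℚ) + 1 ≠ 0 := by positivity
        have hm : (m : ℚ) + 1 ≠ 0 := by positivity
        have hn2 : (n : ℚ) + 1 + 1 ≠ 0 := by positivity
        have x1 : (numAvoidingDecreasing (n + 1) m : ℚ) = (n + 1 + 1 - m) * c / (n + 1 + 1) := by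
          field_simp; linear_combination ihm
        have x2 : (numAvoidingDecreasing n (m + 1) : ℚ) = (n - m) * d / (n + 1) := by
          field_simp; linear_combination ih'
        have x3 : d = c * (n + 1) / (m + 1) := by field_simp; linear_combination e2
        have x4 : e = c * (n + m + 2) / (m + 1) := by field_simp; linear_combination -e1
        rw [x1, x2, x3, x4]
        field_simp
        ring
      · obtain rfl : m = n := by omega
        have hrec : numAvoidingDecreasing (m + 1) (m + 1) = numAvoidingDecreasing (m + 1) m := by
          rw [numAvoidingDecreasing_succ, numAvoidingDecreasing_succ, min_eq_right (by omega),
            min_eq_left (by omega)]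
        have e1 := Nat.add_one_mul_choose_eq (m + m + 1) m
        rw [show m + 1 + (m + 1) = m + m + 1 + 1 by ring, hrec]
        rw [show m + 1 + m = m + m + 1 by ring] at ihm
        qify at e1
        push_cast at *
        rw [ihm]
        have hm : (m : ℚ) + 1 ≠ 0 := by positivity
        apply mul_left_cancel₀ hm
        linear_combination e1

theorem card_avoids123 (n : ℕ) : Nat.card {π : Perm (Fin n) // Avoids123 π} = catalan n := by
  have h := succ_mul_numAvoidingDecreasing n n le_rfl
  have hc := succ_mul_catalan_eq_centralBinom n
  have hB : numAvoidingDecreasing n n = Nat.card {π : Perm (Fin n) // Avoids123 π} :=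
    Nat.card_congr (Equiv.subtypeEquivRight fun σ =>
      and_iff_left (decreasingFrom_of_le σ le_rfl))
  rw [hB, ← two_mul, ← Nat.centralBinom_eq_two_mul_choose, ← hc] at h
  have hn : (n : ℚ) + 1 ≠ 0 := by positivity
  push_cast at h
  exact_mod_cast mul_left_cancel₀ hn (h.trans (by ring) : _ = ((n : ℚ) + 1) * catalan n)

theorem card_avoids123_zero_eq_last (n : ℕ) :
    Nat.card {π : Perm (Fin (n + 1)) // Avoids123 π ∧ π 0 = Fin.last n} = catalan n := by
  rw [card_perm_succ_subtype, Finset.sum_eq_single (Fin.last n), ← card_avoids123]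
  · refine Nat.card_congr (Equiv.subtypeEquivRight fun σ => ?_)
    rw [avoids123_consPerm, consPerm_zero]
    exact ⟨fun h => h.1.1, fun h => ⟨⟨h, decreasingFrom_of_le σ (by simp)⟩, rfl⟩⟩
  · intro v _ hv
    have : IsEmpty {σ : Perm (Fin n) //
          Avoids123 (consPerm v σ) ∧ consPerm v σ 0 = Fin.last n} := ⟨fun σ => hv σ.2.2⟩
    exact Nat.card_of_isEmpty
  · simp

theorem card_avoids123_zero_ne_last (n : ℕ) :
    Nat.card {π : Perm (Fin (n + 1)) // Avoids123 π ∧ π 0 ≠ Fin.last n} + catalan n =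
      catalan (n + 1) := by
  classical
  rw [← card_avoids123_zero_eq_last, ← card_avoids123 (n + 1), add_comm]
  simp only [Nat.card_eq_fintype_card, Fintype.card_subtype]
  rw [← Finset.card_filter_add_card_filter_not (s := {π | Avoids123 π})
    (fun π : Perm (Fin (n + 1)) => π 0 = Fin.last n), Finset.filter_filter, Finset.filter_filter]

/-- Reverse-complement preserves avoidance and exchanges the two boundary conditions. -/
theorem card_avoids123_last_ne_zero (n : ℕ) :
    Nat.card {π : Perm (Fin (n + 1)) // Avoids123 π ∧ π (Fin.last n) ≠ 0} =
      Nat.card {π : Perm (Fin (n + 1)) // Avoids123 π ∧ π 0 ≠ Fin.last n} := by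
  refine Nat.card_congr ((Equiv.equivCongr Fin.revPerm Fin.revPerm).subtypeEquiv fun π => ?_)
  refine and_congr ⟨fun h i j k hij hjk => ?_, fun h i j k hij hjk => ?_⟩ ?_
  · have := h k.rev j.rev i.rev (by simpa) (by simpa)
    simpa [Equiv.equivCongr] using fun a b => this b a
  · have := h k.rev j.rev i.rev (by simpa) (by simpa)
    simp only [Equiv.equivCongr, Equiv.coe_fn_mk, Equiv.trans_apply, Fin.revPerm_symm,
      Fin.revPerm_apply, Fin.rev_rev, Fin.rev_lt_rev] at this
    exact fun a b => this b a
  · simp [Equiv.equivCongr, Fin.rev_eq_iff]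

/-! ### Gluing two avoiders -/

/-- `f` restricts to a permutation of `{0, …, n - 1}`.  Permutations are cut and glued in terms of
functions on `ℕ`, so that positions and values of different lengths can be compared directly. -/
def IsPermBelow (n : ℕ) (f : ℕ → ℕ) : Prop :=
  (∀ t < n, f t < n) ∧ ∀ s < n, ∀ t < n, f s = f t → s = t

/-- The word `f 0, …, f (n - 1)` has no increasing triple. -/
def AvoidsBelow (n : ℕ) (f : ℕ → ℕ) : Prop :=
  ∀ s t u, s < t → t < u → u < n → f s < f t → ¬ f t < f u

/-- The positions `i < p < k` carry the only increasing triple of the word `f 0, …, f (n - 1)`. -/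
def OnlyOccurrence (n : ℕ) (f : ℕ → ℕ) (i p k : ℕ) : Prop :=
  i < p ∧ p < k ∧ k < n ∧ f i < f p ∧ f p < f k ∧
    ∀ s t u, s < t → t < u → u < n → f s < f t → f t < f u → s = i ∧ t = p ∧ u = k

theorem IsPermBelow.image_range {n : ℕ} {f : ℕ → ℕ} (h : IsPermBelow n f) :
    (Finset.range n).image f = Finset.range n := by
  refine Finset.eq_of_subset_of_card_le (fun x hx => ?_) (le_of_eq ?_)
  · obtain ⟨t, ht, rfl⟩ := Finset.mem_image.1 hx
    exact Finset.mem_range.2 (h.1 t (Finset.mem_range.1 ht))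
  · rw [Finset.card_image_of_injOn]
    exact fun s hs t ht => h.2 s (Finset.mem_range.1 hs) t (Finset.mem_range.1 ht)

theorem IsPermBelow.exists_eq {n : ℕ} {f : ℕ → ℕ} (h : IsPermBelow n f) {v : ℕ} (hv : v < n) :
    ∃ t < n, f t = v := by
  have : v ∈ (Finset.range n).image f := by rw [h.image_range]; exact Finset.mem_range.2 hv
  simpa using this

/-- Glues a word `l` on `{0, …, p}` and a word `r` on `{0, …, q}` to a word of length `p + q + 1`.
The word `l` is raised by `q` and `r` is placed to its right, with the minimum of `l` replaced by the
first entry of `r`, the maximum of `r` replaced by the raised last entry of `l`, and the last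
position of `l` merged with the first of `r` into one position of value `q`. -/
def glue (p q : ℕ) (l r : ℕ → ℕ) (t : ℕ) : ℕ :=
  if t < p then if l t = 0 then r 0 else l t + q
  else if t = p then q
  else if r (t - p) = q then l p + q else r (t - p)

section glue

variable {p q : ℕ} {l r : ℕ → ℕ}

theorem glue_left {t : ℕ} (ht : t < p) (h : l t ≠ 0) : glue p q l r t = l t + q := by
  simp [glue, ht, h]

theorem glue_left_zero {t : ℕ} (ht : t < p) (h : l t = 0) : glue p q l r t = r 0 := by
  simp [glue, ht, h]

theorem glue_mid : glue p q l r p = q := by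
  simp [glue]

theorem glue_right {t : ℕ} (ht : 0 < t) (h : r t ≠ q) : glue p q l r (p + t) = r t := by
  simp [glue, ht.ne', h]

theorem glue_right_max {t : ℕ} (ht : 0 < t) (h : r t = q) : glue p q l r (p + t) = l p + q := by
  simp [glue, ht.ne', h]

theorem glue_congr {l' r' : ℕ → ℕ} (hl : ∀ t < p + 1, l t = l' t) (hr : ∀ t < q + 1, r t = r' t)
    {t : ℕ} (ht : t < p + q + 1) : glue p q l r t = glue p q l' r' t := by
  rw [glue, glue, hl p (by omega), hr 0 (by omega), hr (t - p) (by omega)]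
  by_cases h : t < p
  · rw [hl t (by omega)]
  · rw [if_neg h, if_neg h]

theorem glue_isPermBelow (hl : IsPermBelow (p + 1) l) (hr : IsPermBelow (q + 1) r)
    (hlp : l p ≠ 0) (hr0 : r 0 ≠ q) : IsPermBelow (p + q + 1) (glue p q l r) := by
  have := hr.1 0 (by omega)
  have := hl.1 p (by omega)
  refine ⟨fun t ht => ?_, fun s hs t ht hst => ?_⟩
  · rcases lt_trichotomy t p with h | rfl | h
    · have := hl.1 t (by omega)
      unfold glue; split_ifs <;> omega
    · rw [glue_mid]; omega
    · have := hr.1 (t - p) (by omega)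
      unfold glue; split_ifs <;> omega
  · have a₁ := fun h => hl.2 s h t
    have a₂ := fun h => hl.2 s h p
    have a₃ := fun h => hl.2 t h p
    have b₁ := fun h => hr.2 (s - p) h (t - p)
    have b₂ := fun h => hr.2 (s - p) h 0
    have b₃ := fun h => hr.2 (t - p) h 0
    have c₁ := hr.1 (s - p)
    have c₂ := hr.1 (t - p)
    clear hl hr
    unfold glue at hst
    split_ifs at hst <;> omega

theorem glue_onlyOccurrence (hl : IsPermBelow (p + 1) l) (hr : IsPermBelow (q + 1) r)
    (hlp : l p ≠ 0) (hr0 : r 0 ≠ q) (al : AvoidsBelow (p + 1) l) (ar : AvoidsBelow (q + 1) r)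
    {i j : ℕ} (hi : i < p + 1) (hli : l i = 0) (hj : j < q + 1) (hrj : r j = q) :
    OnlyOccurrence (p + q + 1) (glue p q l r) i p (p + j) := by
  have hip : i < p := by
    rcases Nat.lt_succ_iff_lt_or_eq.1 hi with h | rfl
    · exact h
    · exact absurd hli hlp
  have hj0 : 0 < j := by
    rcases Nat.eq_zero_or_pos j with rfl | h
    · exact absurd hrj hr0
    · exact h
  have hrq : r 0 < q := by have := hr.1 0 (by omega); omega
  have gi : glue p q l r i = r 0 := glue_left_zero hip hli
  have gj : glue p q l r (p + j) = l p + q := glue_right_max hj0 hrj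
  have left (t : ℕ) (ht : t < p) (hti : t ≠ i) : glue p q l r t = l t + q ∧ 0 < l t := by
    have : l t ≠ 0 := fun h => hti (hl.2 t (by omega) i hi (h.trans hli.symm))
    exact ⟨glue_left ht this, by omega⟩
  have right (t : ℕ) (ht : p < t) (htN : t < p + q + 1) (htj : t ≠ p + j) :
      glue p q l r t = r (t - p) ∧ r (t - p) < q := by
    have hne : r (t - p) ≠ q := fun h => htj (by
      have := hr.2 (t - p) (by omega) j hj (h.trans hrj.symm)
      omega)
    have := glue_right (p := p) (l := l) (by omega : 0 < t - p) hne
    rw [show p + (t - p) = t by omega] at this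
    have := hr.1 (t - p) (by omega)
    exact ⟨by assumption, by omega⟩
  refine ⟨hip, by omega, by omega, by rw [gi, glue_mid]; exact hrq, by rw [gj, glue_mid]; omega, ?_⟩
  intro s t u hst htu hu h₁ h₂
  have gm : glue p q l r p = q := glue_mid
  generalize glue p q l r = g at *
  -- The minimum of the left part, at `i`, is never the top of an ascent, and dually for the maximum at `p + j`.
  have top (x y : ℕ) (hxy : x < y) (hy : y < p) (h : g x < g y) : g y = l y + q ∧ 0 < l y := by
    refine left y hy fun e => ?_
    subst e
    have := left x (by omega) (by omega)
    omega
  have bot (x y : ℕ) (hx : p < x) (hxy : x < y) (hy : y < p + q + 1) (h : g x < g y) :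
      g x = r (x - p) ∧ r (x - p) < q := by
    refine right x hx (by omega) fun e => ?_
    subst e
    have := right y (by omega) hy (by omega)
    omega
  have lt_left (x y : ℕ) (hx : x < p) (hy : y < p) (hyi : 0 < l y) (e : g y = l y + q)
      (h : g x < g y) : l x < l y := by
    rcases eq_or_ne x i with rfl | hxi
    · omega
    · have := left x hx hxi
      omega
  have lt_right (x y : ℕ) (hx : p < x) (hy : p < y) (hyN : y < p + q + 1) (hyi : r (x - p) < q)
      (e : g x = r (x - p)) (h : g x < g y) : r (x - p) < r (y - p) := by
    rcases eq_or_ne y (p + j) with rfl | hyj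
    · rw [Nat.add_sub_cancel_left, hrj]; exact hyi
    · have := right y hy hyN hyj
      omega
  rcases lt_trichotomy t p with htp | rfl | htp
  · -- The lower two entries lie in the left part.
    exfalso
    have ht := top s t hst htp h₁
    have hs := lt_left s t (by omega) htp ht.2 ht.1 h₁
    rcases lt_trichotomy u p with hup | rfl | hup
    · have hu' := top t u htu hup h₂
      exact al s t u hst htu (by omega) hs (lt_left t u htp hup hu'.2 hu'.1 h₂)
    · omega
    · have : u = p + j := by
        by_contra hne
        have := right u hup hu hne
        omega
      subst this
      exact al s t p hst htp (by omega) hs (by omega)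
  · refine ⟨?_, rfl, ?_⟩
    · by_contra hne
      have := left s hst hne
      omega
    · by_contra hne
      have := right u htu hu hne
      omega
  · -- The upper two entries lie in the right part.
    exfalso
    have ht := bot t u htp htu hu h₂
    have hs := lt_right t u htp (by omega) hu ht.2 ht.1 h₂
    rcases lt_trichotomy s p with hsp | rfl | hsp
    · have : s = i := by
        by_contra hne
        have := left s hsp hne
        omega
      subst this
      exact ar 0 (t - p) (u - p) (by omega) (by omega) (by omega) (by omega) hs
    · omega
    · have hs' := bot s t hsp hst (by omega) h₁
      exact ar (s - p) (t - p) (u - p) (by omega) (by omega) (by omega)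
        (lt_right s t hsp htp (by omega) hs'.2 hs'.1 h₁) hs

/-- Since `r 0 < q`, the position of the minimum of `l` is visible in the glued word as the only
value below `q` before position `p`, and dually for the maximum of `r`. -/
theorem glue_injective {l' r' : ℕ → ℕ}
    (hl : IsPermBelow (p + 1) l) (hr : IsPermBelow (q + 1) r) (hlp : l p ≠ 0) (hr0 : r 0 ≠ q)
    (hr' : IsPermBelow (q + 1) r') (hlp' : l' p ≠ 0)
    (h : ∀ t < p + q + 1, glue p q l r t = glue p q l' r' t) :
    (∀ t < p + 1, l t = l' t) ∧ ∀ t < q + 1, r t = r' t := by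
  have r0 := hr.1 0 (by omega)
  have r0' := hr'.1 0 (by omega)
  constructor
  · intro t ht
    rcases Nat.lt_succ_iff_lt_or_eq.1 ht with htp | rfl
    · have := h t (by omega)
      simp only [glue, htp, if_true] at this
      split_ifs at this <;> omega
    · obtain ⟨j, hj, hrj⟩ := hr.exists_eq (Nat.lt_succ_self q)
      have hj0 : j ≠ 0 := by rintro rfl; exact hr0 hrj
      have := h (t + j) (by omega)
      have := hr'.1 j hj
      rw [glue_right_max (by omega) hrj] at *
      simp [glue, hj0] at *
      split_ifs at * <;> omega
  · intro t ht
    rcases Nat.eq_zero_or_pos t with rfl | ht0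
    · obtain ⟨i, hi, hli⟩ := hl.exists_eq (Nat.succ_pos p)
      have hip : i < p := by
        rcases Nat.lt_succ_iff_lt_or_eq.1 hi with h | rfl
        · exact h
        · exact absurd hli hlp
      have := h i (by omega)
      rw [glue_left_zero hip hli] at this
      simp only [glue, hip, if_true] at this
      split_ifs at this <;> omega
    · have := h (p + t) (by omega)
      have := hr.1 t ht
      have := hr'.1 t ht
      simp [glue, ht0.ne'] at *
      split_ifs at * <;> omega

end glue

/-! ### Cutting at the middle of the unique occurrence -/

section split

variable {p q i k : ℕ} {f : ℕ → ℕ}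

/-- The word of the entries `≥ q` of `f`, lowered by `q`: the positions before `p` and then the entry
`f k`.  At the position of the first entry of the occurrence, whose value is below `q`, the truncated
subtraction produces the required minimum `0`. -/
def leftPart (p q k : ℕ) (f : ℕ → ℕ) (t : ℕ) : ℕ := (if t = p then f k else f t) - q

/-- The word of the entries `≤ q` of `f`: the entry `f i` and then the positions after `p`.  At the
position of the last entry of the occurrence, whose value exceeds `q`, the minimum produces the
required maximum `q`. -/
def rightPart (p q i : ℕ) (f : ℕ → ℕ) (t : ℕ) : ℕ := if t = 0 then f i else min (f (p + t)) q

theorem OnlyOccurrence.lt_of_left {n : ℕ} (h : OnlyOccurrence n f i p k) (hf : IsPermBelow n f)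
    {t : ℕ} (ht : t < p) (hti : t ≠ i) : f p < f t := by
  obtain ⟨hip, hpk, hk, h₁, h₂, huniq⟩ := h
  by_contra hlt
  have hne : f t ≠ f p := fun e => by
    have := hf.2 t (by omega) p (by omega) e
    omega
  exact hti (huniq t p k ht hpk hk (by omega) h₂).1

theorem OnlyOccurrence.lt_of_right {n : ℕ} (h : OnlyOccurrence n f i p k) (hf : IsPermBelow n f)
    {t : ℕ} (ht : p < t) (htn : t < n) (htk : t ≠ k) : f t < f p := by
  obtain ⟨hip, hpk, hk, h₁, h₂, huniq⟩ := h
  by_contra hlt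
  have hne : f t ≠ f p := fun e => by
    have := hf.2 t (by omega) p (by omega) e
    omega
  exact htk (huniq i p t hip ht htn h₁ (by omega)).2.2

/-- The entries above `f p` sit in the `p - 1` positions before `p` other than `i`, and in `k`; so there
are `p` of them, which determines `f p`. -/
theorem OnlyOccurrence.apply_mid (h : OnlyOccurrence (p + q + 1) f i p k)
    (hf : IsPermBelow (p + q + 1) f) : f p = q := by
  have key : ((Finset.range p).erase i ∪ {k}).image f = Finset.Ioo (f p) (p + q + 1) := by
    ext v
    simp only [Finset.mem_image, Finset.mem_union, Finset.mem_erase, Finset.mem_range,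
      Finset.mem_singleton, Finset.mem_Ioo]
    constructor
    · rintro ⟨t, ⟨hti, ht⟩ | rfl, rfl⟩
      · exact ⟨h.lt_of_left hf ht hti, hf.1 t (by omega)⟩
      · exact ⟨h.2.2.2.2.1, hf.1 t h.2.2.1⟩
    · rintro ⟨hv, hvn⟩
      obtain ⟨t, ht, rfl⟩ := hf.exists_eq hvn
      refine ⟨t, ?_, rfl⟩
      by_contra hcon
      push Not at hcon
      rcases lt_trichotomy t p with htp | rfl | htp
      · by_cases hti : t = i
        · subst hti
          have := h.2.2.2.1
          omega
        · exact absurd htp (by have := hcon.1 hti; omega)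
      · omega
      · have := h.lt_of_right hf htp ht hcon.2
        omega
  have hcard := congrArg Finset.card key
  obtain ⟨hip, hpk, hk, -, -, -⟩ := h
  have := hf.1 p (by omega)
  rw [Finset.card_image_of_injOn, Finset.card_union_of_disjoint, Finset.card_erase_of_mem,
    Finset.card_range, Finset.card_singleton, Nat.card_Ioo] at hcard
  · omega
  · exact Finset.mem_range.2 hip
  · simp only [Finset.disjoint_singleton_right, Finset.mem_erase, Finset.mem_range]
    omega
  · intro s hs t ht
    simp only [Finset.coe_union, Finset.coe_erase, Finset.coe_range, Finset.coe_singleton,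
      Set.mem_union, Set.mem_sdiff, Set.mem_Iio, Set.mem_singleton_iff] at hs ht
    exact hf.2 s (by omega) t (by omega)

theorem isPermBelow_leftPart (h : OnlyOccurrence (p + q + 1) f i p k)
    (hf : IsPermBelow (p + q + 1) f) : IsPermBelow (p + 1) (leftPart p q k f) := by
  have hq := h.apply_mid hf
  have hl (t : ℕ) := h.lt_of_left hf (t := t)
  obtain ⟨hip, hpk, hk, h₁, h₂, -⟩ := h
  have hk' := hf.1 k hk
  constructor
  · intro t ht
    have := hf.1 t (by omega)
    unfold leftPart
    split_ifs <;> omega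
  · intro s hs t ht hst
    have a₁ := hf.2 s (by omega) t (by omega)
    have a₂ := hf.2 s (by omega) k (by omega)
    have a₃ := hf.2 t (by omega) k (by omega)
    have := hl s
    have := hl t
    clear hf hl
    unfold leftPart at hst
    split_ifs at hst <;> omega

theorem isPermBelow_rightPart (h : OnlyOccurrence (p + q + 1) f i p k)
    (hf : IsPermBelow (p + q + 1) f) : IsPermBelow (q + 1) (rightPart p q i f) := by
  have hq := h.apply_mid hf
  have hr (t : ℕ) := h.lt_of_right hf (t := t)
  obtain ⟨hip, hpk, hk, h₁, h₂, -⟩ := h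
  have hk' := hf.1 k hk
  constructor
  · intro t ht
    unfold rightPart
    split_ifs <;> omega
  · intro s hs t ht hst
    have a₁ := hf.2 (p + s) (by omega) (p + t) (by omega)
    have a₂ := hf.2 (p + s) (by omega) i (by omega)
    have a₃ := hf.2 (p + t) (by omega) i (by omega)
    have := hr (p + s)
    have := hr (p + t)
    clear hf hr
    unfold rightPart at hst
    split_ifs at hst <;> omega

theorem avoidsBelow_leftPart (h : OnlyOccurrence (p + q + 1) f i p k)
    (hf : IsPermBelow (p + q + 1) f) : AvoidsBelow (p + 1) (leftPart p q k f) := by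
  intro s t u hst htu hu h₁ h₂
  have hq := h.apply_mid hf
  obtain ⟨hip, hpk, hk, -, -, huniq⟩ := h
  have a := huniq s t u hst htu
  have b := huniq s t k hst
  clear huniq hf
  unfold leftPart at h₁ h₂
  split_ifs at h₁ h₂ <;> omega

theorem avoidsBelow_rightPart (h : OnlyOccurrence (p + q + 1) f i p k)
    (hf : IsPermBelow (p + q + 1) f) : AvoidsBelow (q + 1) (rightPart p q i f) := by
  intro s t u hst htu hu h₁ h₂
  have hq := h.apply_mid hf
  obtain ⟨hip, hpk, hk, -, -, huniq⟩ := h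
  have a := huniq (p + s) (p + t) (p + u)
  have b := huniq i (p + t) (p + u)
  clear huniq hf
  unfold rightPart at h₁ h₂
  split_ifs at h₁ h₂ <;> omega

theorem leftPart_ne_zero (h : OnlyOccurrence (p + q + 1) f i p k)
    (hf : IsPermBelow (p + q + 1) f) : leftPart p q k f p ≠ 0 := by
  have hq := h.apply_mid hf
  have := h.2.2.2.2.1
  simp only [leftPart, if_true]
  omega

theorem rightPart_ne (h : OnlyOccurrence (p + q + 1) f i p k)
    (hf : IsPermBelow (p + q + 1) f) : rightPart p q i f 0 ≠ q := by
  have hq := h.apply_mid hf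
  have := h.2.2.2.1
  simp only [rightPart, if_true]
  omega

theorem glue_leftPart_rightPart (h : OnlyOccurrence (p + q + 1) f i p k)
    (hf : IsPermBelow (p + q + 1) f) {t : ℕ} (ht : t < p + q + 1) :
    glue p q (leftPart p q k f) (rightPart p q i f) t = f t := by
  have hq := h.apply_mid hf
  have hl := h.lt_of_left hf (t := t)
  have hr := h.lt_of_right hf (t := t)
  obtain ⟨hip, hpk, hk, h₁, h₂, -⟩ := h
  rcases lt_trichotomy t p with htp | rfl | htp
  · rcases eq_or_ne t i with rfl | hti
    · rw [glue_left_zero htp] <;> simp only [leftPart, rightPart, htp.ne, if_true, if_false]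
      omega
    · have := hl htp hti
      rw [glue_left htp] <;> simp only [leftPart, htp.ne, if_false] <;> omega
  · rw [glue_mid, hq]
  · obtain ⟨s, rfl⟩ := Nat.exists_eq_add_of_lt htp
    rw [add_assoc] at *
    rcases eq_or_ne (p + (s + 1)) k with hk' | hk'
    · rw [glue_right_max (by omega)]
      · simp only [leftPart, if_true, hk']
        omega
      · simp only [rightPart, Nat.succ_ne_zero, if_false, hk']
        omega
    · have := hr htp ht hk'
      rw [glue_right (by omega)] <;> simp only [rightPart, Nat.succ_ne_zero, if_false] <;> omega

end split

/-! ### Counting by the position of the middle entry -/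

section perm

variable {n : ℕ}

/-- A permutation of `Fin n` as a function on `ℕ`, extended by the identity. -/
def natFun (π : Perm (Fin n)) (t : ℕ) : ℕ := if h : t < n then π ⟨t, h⟩ else t

@[simp] theorem natFun_val (π : Perm (Fin n)) (i : Fin n) : natFun π i = π i := by
  simp [natFun]

theorem natFun_of_lt (π : Perm (Fin n)) {t : ℕ} (h : t < n) : natFun π t = π ⟨t, h⟩ :=
  dif_pos h

theorem isPermBelow_natFun (π : Perm (Fin n)) : IsPermBelow n (natFun π) := by
  refine ⟨fun t ht => ?_, fun s hs t ht h => ?_⟩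
  · rw [natFun_of_lt π ht]; exact Fin.isLt _
  · rw [natFun_of_lt π hs, natFun_of_lt π ht] at h
    simpa using π.injective (Fin.ext h)

/-- The permutation of `Fin n` given by a function that permutes `{0, …, n - 1}`. -/
noncomputable def IsPermBelow.toPerm {f : ℕ → ℕ} (h : IsPermBelow n f) : Perm (Fin n) :=
  Equiv.ofBijective (fun t : Fin n => ⟨f t, h.1 t t.isLt⟩) <|
    Finite.injective_iff_bijective.1 fun s t hst =>
      Fin.ext (h.2 s s.isLt t t.isLt (congrArg Fin.val hst))

theorem IsPermBelow.natFun_toPerm {f : ℕ → ℕ} (h : IsPermBelow n f) {t : ℕ} (ht : t < n) :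
    natFun h.toPerm t = f t := by
  rw [natFun_of_lt _ ht]; rfl

theorem perm_ext_natFun {π σ : Perm (Fin n)} (h : ∀ t < n, natFun π t = natFun σ t) : π = σ :=
  Equiv.ext fun i => Fin.ext (by simpa using h i i.isLt)

theorem avoidsBelow_natFun {π : Perm (Fin n)} : AvoidsBelow n (natFun π) ↔ Avoids123 π := by
  constructor
  · intro h i j k hij hjk h₁ h₂
    exact h i j k hij hjk k.isLt (by simpa using h₁) (by simpa using h₂)
  · intro h s t u hst htu hu h₁ h₂
    rw [natFun_of_lt π (by omega), natFun_of_lt π (by omega)] at h₁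
    rw [natFun_of_lt π (by omega), natFun_of_lt π (by omega)] at h₂
    exact h ⟨s, by omega⟩ ⟨t, by omega⟩ ⟨u, hu⟩ hst htu h₁ h₂

theorem AvoidsBelow.congr {f g : ℕ → ℕ} (h : AvoidsBelow n f) (hfg : ∀ t < n, g t = f t) :
    AvoidsBelow n g := by
  intro s t u hst htu hu
  rw [hfg s (by omega), hfg t (by omega), hfg u hu]
  exact h s t u hst htu hu

theorem OnlyOccurrence.congr {f g : ℕ → ℕ} {i p k : ℕ} (h : OnlyOccurrence n f i p k)
    (hfg : ∀ t < n, g t = f t) : OnlyOccurrence n g i p k := by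
  obtain ⟨hip, hpk, hk, h₁, h₂, huniq⟩ := h
  refine ⟨hip, hpk, hk, ?_, ?_, fun s t u hst htu hu => ?_⟩
  · rwa [hfg i (by omega), hfg p (by omega)]
  · rwa [hfg k (by omega), hfg p (by omega)]
  · rw [hfg s (by omega), hfg t (by omega), hfg u hu]
    exact huniq s t u hst htu hu

/-- The permutation has exactly one increasing triple, and its middle entry is in position `p`. -/
def HasMiddle (π : Perm (Fin n)) (p : ℕ) : Prop := ∃ i k, OnlyOccurrence n (natFun π) i p k

/-- Gluing is a bijection from the pairs of avoiders with the two boundary conditions onto the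
permutations with a single increasing triple whose middle is in position `p`. -/
theorem card_hasMiddle (p q : ℕ) :
    Nat.card {π : Perm (Fin (p + q + 1)) // HasMiddle π p} =
      Nat.card {π : Perm (Fin (p + 1)) // Avoids123 π ∧ π (Fin.last p) ≠ 0} *
        Nat.card {π : Perm (Fin (q + 1)) // Avoids123 π ∧ π 0 ≠ Fin.last q} := by
  have hL {π : Perm (Fin (p + 1))} : natFun π p ≠ 0 ↔ π (Fin.last p) ≠ 0 := by
    rw [natFun_of_lt π (Nat.lt_succ_self p), Ne, Ne, Fin.ext_iff]; rfl
  have hR {π : Perm (Fin (q + 1))} : natFun π 0 ≠ q ↔ π 0 ≠ Fin.last q := by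
    rw [natFun_of_lt π (Nat.succ_pos q), Ne, Ne, Fin.ext_iff]; rfl
  have hglue (l : Perm (Fin (p + 1))) (r : Perm (Fin (q + 1))) (hl : l (Fin.last p) ≠ 0)
      (hr : r 0 ≠ Fin.last q) : IsPermBelow (p + q + 1) (glue p q (natFun l) (natFun r)) :=
    glue_isPermBelow (isPermBelow_natFun l) (isPermBelow_natFun r) (hL.2 hl) (hR.2 hr)
  have hmid (l : Perm (Fin (p + 1))) (r : Perm (Fin (q + 1))) (al : Avoids123 l)
      (hl : l (Fin.last p) ≠ 0) (ar : Avoids123 r) (hr : r 0 ≠ Fin.last q) :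
      HasMiddle (hglue l r hl hr).toPerm p := by
    obtain ⟨i, hi, hli⟩ := (isPermBelow_natFun l).exists_eq (Nat.succ_pos p)
    obtain ⟨j, hj, hrj⟩ := (isPermBelow_natFun r).exists_eq (Nat.lt_succ_self q)
    exact ⟨i, p + j, (glue_onlyOccurrence (isPermBelow_natFun l) (isPermBelow_natFun r)
      (hL.2 hl) (hR.2 hr) (avoidsBelow_natFun.2 al) (avoidsBelow_natFun.2 ar) hi hli hj hrj).congr
      fun t ht => IsPermBelow.natFun_toPerm _ ht⟩
  rw [← Nat.card_prod]
  refine (Nat.card_congr (Equiv.ofBijective (fun x => ⟨_, hmid x.1.1 x.2.1 x.1.2.1 x.1.2.2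
    x.2.2.1 x.2.2.2⟩) ⟨?_, ?_⟩)).symm
  · rintro ⟨⟨l, al, hl⟩, r, ar, hr⟩ ⟨⟨l', al', hl'⟩, r', ar', hr'⟩ h
    have h' := congrArg Subtype.val h
    obtain ⟨e₁, e₂⟩ := glue_injective (isPermBelow_natFun l) (isPermBelow_natFun r) (hL.2 hl)
      (hR.2 hr) (isPermBelow_natFun r') (hL.2 hl') fun t ht => by
        have := congrArg (fun π => natFun π t) h'
        simpa only [IsPermBelow.natFun_toPerm _ ht] using this
    obtain rfl := perm_ext_natFun e₁
    obtain rfl := perm_ext_natFun e₂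
    rfl
  · rintro ⟨π, i, k, h⟩
    have hπ := isPermBelow_natFun π
    have pl := isPermBelow_leftPart h hπ
    have pr := isPermBelow_rightPart h hπ
    refine ⟨⟨⟨pl.toPerm, avoidsBelow_natFun.1 ((avoidsBelow_leftPart h hπ).congr
      fun t ht => pl.natFun_toPerm ht), hL.1 ?_⟩, ⟨pr.toPerm, avoidsBelow_natFun.1
      ((avoidsBelow_rightPart h hπ).congr fun t ht => pr.natFun_toPerm ht), hR.1 ?_⟩⟩, ?_⟩
    · rw [pl.natFun_toPerm (Nat.lt_succ_self p)]
      exact leftPart_ne_zero h hπ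
    · rw [pr.natFun_toPerm (Nat.succ_pos q)]
      exact rightPart_ne h hπ
    · refine Subtype.ext (perm_ext_natFun fun t ht => ?_)
      rw [IsPermBelow.natFun_toPerm _ ht, ← glue_leftPart_rightPart h hπ ht]
      exact glue_congr (fun t ht => pl.natFun_toPerm ht) (fun t ht => pr.natFun_toPerm ht) ht

theorem mem_patternOccurrences_pattern123 {π : Perm (Fin n)} {f : Fin 3 → Fin n} :
    f ∈ patternOccurrences pattern123 π ↔
      (f 0 < f 1 ∧ f 1 < f 2) ∧ π (f 0) < π (f 1) ∧ π (f 1) < π (f 2) := by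
  rw [patternOccurrences, Finset.mem_filter, and_iff_right (Finset.mem_univ f)]
  simp only [pattern123, Equiv.Perm.coe_one, id]
  constructor
  · rintro ⟨h, h'⟩
    exact ⟨⟨h 0 1 (by decide), h 1 2 (by decide)⟩, (h' 0 1).2 (by decide), (h' 1 2).2 (by decide)⟩
  · rintro ⟨⟨h₁, h₂⟩, h₃, h₄⟩
    have hf : StrictMono f := Fin.strictMono_iff_lt_succ.2 fun i => by
      fin_cases i <;> assumption
    have hπ : StrictMono (π ∘ f) := Fin.strictMono_iff_lt_succ.2 fun i => by
      fin_cases i <;> assumption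
    exact ⟨fun a b h => hf h, fun a b => hπ.lt_iff_lt⟩

theorem mem_permsWithOccurrences_one_iff {π : Perm (Fin n)} :
    π ∈ permsWithOccurrences pattern123 1 n ↔ ∃ p : Fin n, HasMiddle π p := by
  simp only [permsWithOccurrences, Finset.mem_filter, Finset.mem_univ, true_and,
    Finset.card_eq_one, Finset.eq_singleton_iff_unique_mem, mem_patternOccurrences_pattern123]
  constructor
  · rintro ⟨f, ⟨⟨h₁, h₂⟩, h₃, h₄⟩, huniq⟩
    refine ⟨f 1, f 0, f 2, h₁, h₂, (f 2).isLt, by simpa, by simpa,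
      fun s t u hst htu hu h h' => ?_⟩
    rw [natFun_of_lt π (by omega), natFun_of_lt π (by omega)] at h
    rw [natFun_of_lt π (by omega), natFun_of_lt π (by omega)] at h'
    have := huniq ![⟨s, by omega⟩, ⟨t, by omega⟩, ⟨u, hu⟩] ⟨⟨hst, htu⟩, h, h'⟩
    rw [← this]
    exact ⟨rfl, rfl, rfl⟩
  · rintro ⟨p, i, k, hip, hpk, hk, h₁, h₂, huniq⟩
    have hi : i < n := by omega
    rw [natFun_of_lt π hi, natFun_val] at h₁
    rw [natFun_of_lt π hk, natFun_val] at h₂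
    refine ⟨![⟨i, hi⟩, p, ⟨k, hk⟩], ⟨⟨hip, hpk⟩, h₁, h₂⟩, fun f hf => ?_⟩
    obtain ⟨⟨g₁, g₂⟩, g₃, g₄⟩ := hf
    obtain ⟨e₀, e₁, e₂⟩ := huniq (f 0) (f 1) (f 2) g₁ g₂ (f 2).isLt (by simpa) (by simpa)
    funext a
    fin_cases a
    · exact Fin.ext e₀
    · exact Fin.ext e₁
    · exact Fin.ext e₂

theorem HasMiddle.unique {π : Perm (Fin n)} {p p' : ℕ} (h : HasMiddle π p)
    (h' : HasMiddle π p') : p = p' := by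
  obtain ⟨i, k, hip, hpk, hk, h₁, h₂, -⟩ := h
  obtain ⟨i', k', -, -, -, -, -, huniq⟩ := h'
  exact (huniq i p k hip hpk hk h₁ h₂).2.1

theorem numOne123_eq_sum (n : ℕ) :
    numOne123 n = ∑ p : Fin n, Nat.card {π : Perm (Fin n) // HasMiddle π p} := by
  classical
  simp only [Nat.card_eq_fintype_card, Fintype.card_subtype]
  rw [numOne123, ← Finset.card_biUnion]
  · congr 1
    ext π
    simp [mem_permsWithOccurrences_one_iff]
  · intro p _ p' _ hne
    refine Finset.disjoint_left.2 fun π hπ hπ' => hne (Fin.ext ?_)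
    exact (Finset.mem_filter.1 hπ).2.unique (Finset.mem_filter.1 hπ').2

theorem numOne123_succ (n : ℕ) :
    (numOne123 (n + 1) : ℚ) = ∑ x ∈ Finset.HasAntidiagonal.antidiagonal n,
      ((catalan (x.1 + 1) : ℚ) - catalan x.1) * (catalan (x.2 + 1) - catalan x.2) := by
  rw [numOne123_eq_sum,
    Fin.sum_univ_eq_sum_range (fun p => Nat.card {π : Perm (Fin (n + 1)) // HasMiddle π p}),
    ← Finset.Nat.sum_antidiagonal_eq_sum_range_succ
      (fun p _ => Nat.card {π : Perm (Fin (n + 1)) // HasMiddle π p})]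
  push_cast
  refine Finset.sum_congr rfl fun ⟨p, q⟩ hx => ?_
  obtain rfl := Finset.HasAntidiagonal.mem_antidiagonal.1 hx
  have h (m : ℕ) : (Nat.card {π : Perm (Fin (m + 1)) // Avoids123 π ∧ π 0 ≠ Fin.last m} : ℚ) =
      catalan (m + 1) - catalan m := by
    rw [eq_sub_iff_add_eq]
    exact_mod_cast card_avoids123_zero_ne_last m
  rw [card_hasMiddle, card_avoids123_last_ne_zero, Nat.cast_mul, h, h]

end perm

/-! ### Generating functions -/

section series

open PowerSeries

theorem coeff_catalanGF (n : ℕ) : coeff n catalanGF = (catalan n : ℚ) := by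
  simp [catalanGF]

theorem catalanGF_eq : catalanGF = 1 + X * catalanGF ^ 2 := by
  have := congrArg (PowerSeries.map (Nat.castRingHom ℚ)) catalanSeries_sq_mul_X_add_one
  simp only [map_add, map_mul, map_pow, map_one, PowerSeries.map_X] at this
  rw [catalanGF]
  linear_combination -this

theorem coeff_X_mul_catalanGF_pow_three (n : ℕ) :
    coeff n (X * catalanGF ^ 3) = (catalan (n + 1) : ℚ) - catalan n := by
  have h : X * (X * catalanGF ^ 3) = catalanGF - 1 - X * catalanGF := by
    linear_combination (-X * catalanGF - 1) * catalanGF_eq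
  rw [← coeff_succ_X_mul, h]
  simp [coeff_succ_X_mul, coeff_catalanGF, coeff_one]

theorem mk_numOne123 :
    PowerSeries.mk (fun n : ℕ => (numOne123 n : ℚ)) = X ^ 3 * catalanGF ^ 6 := by
  have h : X ^ 3 * catalanGF ^ 6 = X * (X * catalanGF ^ 3 * (X * catalanGF ^ 3)) := by ring
  rw [h]
  ext n
  cases n with
  | zero => simp [numOne123_eq_sum]
  | succ n =>
    rw [coeff_succ_X_mul, coeff_mul, coeff_mk, numOne123_succ]
    simp only [coeff_X_mul_catalanGF_pow_three]

theorem coeff_X_pow_three_mul_catalanGF_pow_six (n : ℕ) :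
    coeff (n + 3) (X ^ 3 * catalanGF ^ 6) =
      (catalan (n + 5) : ℚ) - 4 * catalan (n + 4) + 3 * catalan (n + 3) := by
  have h : X ^ 2 * (X ^ 3 * catalanGF ^ 6) =
      catalanGF - X * (4 * catalanGF) + X ^ 2 * (3 * catalanGF) - 1 + X * 3 - X ^ 2 := by
    have e : X * catalanGF ^ 2 = catalanGF - 1 := by linear_combination -catalanGF_eq
    have e' : X ^ 3 * catalanGF ^ 6 = (catalanGF - 1) ^ 3 := by rw [← e]; ring
    rw [e']
    linear_combination (X * catalanGF - 3 * X + 1) * e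
  rw [← coeff_X_pow_mul _ 2 (n + 3), h]
  have h4 : (4 : PowerSeries ℚ) = C 4 := (map_ofNat C 4).symm
  have h3 : (3 : PowerSeries ℚ) = C 3 := (map_ofNat C 3).symm
  simp only [map_add, map_sub, coeff_succ_X_mul, coeff_X_pow_mul, coeff_one, coeff_X_pow, h4, h3,
    coeff_C_mul, coeff_catalanGF, coeff_C]
  simp

theorem succ_succ_mul_catalan_succ (n : ℕ) :
    ((n : ℚ) + 2) * catalan (n + 1) = 2 * (2 * n + 1) * catalan n := by
  have h₁ := succ_mul_catalan_eq_centralBinom n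
  have h₂ := succ_mul_catalan_eq_centralBinom (n + 1)
  have h₃ := Nat.succ_mul_centralBinom_succ n
  rw [← h₁, ← h₂] at h₃
  qify at h₃
  have hn : (n : ℚ) + 1 ≠ 0 := by positivity
  apply mul_left_cancel₀ hn
  linear_combination h₃

theorem catalan_combination_eq_choose (n : ℕ) :
    (catalan (n + 5) : ℚ) - 4 * catalan (n + 4) + 3 * catalan (n + 3) =
      6 / ((n : ℚ) + 6) * (2 * n + 5).choose (n + 5) := by
  have h₁ := succ_succ_mul_catalan_succ (n + 3)
  have h₂ := succ_succ_mul_catalan_succ (n + 4)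
  have h₃ := succ_mul_catalan_eq_centralBinom (n + 3)
  have h₄ : (((n : ℚ) + 4) * catalan (n + 3)) =
      (2 * (n + 3)).factorial / ((n + 3).factorial * (n + 3).factorial) := by
    rw [Nat.centralBinom_eq_two_mul_choose] at h₃
    qify at h₃
    rw [Nat.cast_choose ℚ (by omega)] at h₃
    rw [show 2 * (n + 3) - (n + 3) = n + 3 by omega] at h₃
    linear_combination h₃
  rw [Nat.cast_choose ℚ (by omega), show 2 * n + 5 - (n + 5) = n by omega]
  rw [show 2 * (n + 3) = (2 * n + 5) + 1 by ring, Nat.factorial_succ (2 * n + 5)] at h₄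
  rw [show (n + 5).factorial = (n + 5) * ((n + 4) * (n + 3).factorial) by
    rw [Nat.factorial_succ, Nat.factorial_succ]]
  rw [show (n + 3).factorial = (n + 3) * ((n + 2) * ((n + 1) * n.factorial)) by
    rw [Nat.factorial_succ, Nat.factorial_succ, Nat.factorial_succ]] at *
  push_cast at *
  have hf : (n.factorial : ℚ) ≠ 0 := by exact_mod_cast n.factorial_ne_zero
  have hn4 : (n : ℚ) + 4 ≠ 0 := by positivity
  have hn5 : (n : ℚ) + 5 ≠ 0 := by positivity
  have hn6 : (n : ℚ) + 6 ≠ 0 := by positivity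
  generalize ((2 * n + 5).factorial : ℚ) = F at *
  generalize (n.factorial : ℚ) = G at *
  have k₃ : (catalan (n + 3) : ℚ) = (2 * n + 6) * F /
      ((n + 4) * ((n + 3) * (n + 2) * (n + 1) * G) ^ 2) := by
    apply mul_left_cancel₀ hn4
    rw [h₄]
    field_simp
    ring
  have k₄ : (catalan (n + 4) : ℚ) = 2 * (2 * n + 7) / (n + 5) * catalan (n + 3) := by
    field_simp
    linear_combination h₁
  have k₅ : (catalan (n + 5) : ℚ) = 2 * (2 * n + 9) / (n + 6) * catalan (n + 4) := by
    field_simp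
    linear_combination h₂
  rw [k₅, k₄, k₃]
  field_simp
  ring

theorem coeff_X_pow_three_mul_catalanGF_pow_six_eq_choose {n : ℕ} (hn : 3 ≤ n) :
    coeff n (X ^ 3 * catalanGF ^ 6) =
      (6 : ℚ) / ((n : ℚ) + 3) * ((2 * n - 1).choose (n + 2) : ℚ) := by
  obtain ⟨m, rfl⟩ := Nat.exists_eq_add_of_le' hn
  rw [coeff_X_pow_three_mul_catalanGF_pow_six, catalan_combination_eq_choose,
    show 2 * (m + 3) - 1 = 2 * m + 5 by omega]
  push_cast
  ring_nf

end series

theorem theorem9 :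
    PowerSeries.mk (fun n : ℕ => (numOne123 n : ℚ)) = PowerSeries.X ^ 3 * catalanGF ^ 6 ∧
    PowerSeries.X ^ 3 * catalanGF ^ 6 =
      PowerSeries.mk (fun n : ℕ =>
        if 3 ≤ n then (6 : ℚ) / ((n : ℚ) + 3) * ((2 * n - 1).choose (n + 2) : ℚ) else 0) ∧
    (∀ n : ℕ, 3 ≤ n →
      (numOne123 n : ℚ) = (6 : ℚ) / ((n : ℚ) + 3) * ((2 * n - 1).choose (n + 2) : ℚ)) := by
  refine ⟨mk_numOne123, ?_, fun n hn => ?_⟩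
  · ext n
    rw [PowerSeries.coeff_mk]
    split_ifs with hn
    · exact coeff_X_pow_three_mul_catalanGF_pow_six_eq_choose hn
    · rw [PowerSeries.coeff_X_pow_mul', if_neg hn]
  · rw [← coeff_X_pow_three_mul_catalanGF_pow_six_eq_choose hn, ← mk_numOne123,
      PowerSeries.coeff_mk]
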